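/- Let $\lambda=(\lambda_1,\dots,\lambda_d)$, $d\ge 1$, be a sequence of positive integers with sum $n$. Let $$\widetilde{\mathcal P}_{d+1}(\lambda)=\mathrm{conv}\{(x,\,x_1^2+\cdots+x_d^2) : x\in\mathbb Z^d,\ 0\le x_i\le\lambda_i \text{ for } 1\le i\le d\}\subset\mathbb R^{d+1},$$ and let $\pi:\widetilde{\mathcal P}_{d+1}(\lambda)\to[0,n]$, $\pi(x)=x_1+\cdots+x_d$. Let $$\Pi_d(\lambda)=\Big\{\tfrac1n\int_0^n\gamma(t)\,dt \;:\; \gamma:[0,n]\to\widetilde{\mathcal P}_{d+1}(\lambda)\text{ continuous},\ \pi\circ\gamma=\mathrm{id}\Big\}\subset\mathbb R^{d+1}$$ be the monotone path polytope of $\pi$. Let $\mathcal A_d(\lambda)$ be the arrangement in $\mathbb R^d$ of the hyperplanes $x_i-x_j=s$ for $1\le i<j\le d$ and integers $s$ with $-\lambda_i+1\le s\le\lambda_j-1$. Its cone $\mathbf c\mathcal A_d(\lambda)$ is the linear arrangement in $\mathbb R^{d+1}$ of the hyperplanes $x_i-x_j=s\,x_{d+1}$ (for the same $i,j,s$) and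 $x_{d+1}=0$. Choose a nonzero normal vector $v_H$ for each $H\in\mathbf c\mathcal A_d(\lambda)$ (the choice is arbitrary), let $Z[\mathbf c\mathcal A_d(\lambda)]=\sum_{H}[-v_H,v_H]$ be the associated zonotope, and let the polar complex $Z[\mathcal A_d(\lambda)]$ be the complex of its lower faces. Here the lower faces of a polytope $P\subset\mathbb R^{d+1}$ are the nonempty faces on which some linear functional $c(x)=a_1x_1+\cdots+a_{d+1}x_{d+1}$ with $a_{d+1}>0$ attains its minimum over $P$, and a lower vertex is a point that is a lower face by itself. Then the complex of all lower faces of $\Pi_d(\lambda)$ is combinatorially equivalent to $Z[\mathcal A_d(\lambda)]$, that is, the two sets of lower faces, ordered by inclusion, are isomorphic posets. In particular, the lower vertices of $\Pi_d(\lambda)$ are in bijection with the regions of $\mathcal A_d(\lambda)$, that is, with the connected components of the complement in $\mathbb R^d$ of the union of its hyperplanes. -/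

import Mathlib

open scoped Pointwise

noncomputable section

namespace MonotonePath

/-- The space `ℝ^{d+1}`, written as `ℝ^d × ℝ`: the second component is the last coordinate, and the
canonical projection is `Prod.fst`. -/
abbrev Space (d : ℕ) : Type := (Fin d → ℝ) × ℝ

/-- The box `B(lam) = {x | 0 ≤ x_i ≤ lam_i}`. -/
def box {d : ℕ} (lam : Fin d → ℕ) : Set (Fin d → ℝ) :=
  {x | ∀ i, 0 ≤ x i ∧ x i ≤ (lam i : ℝ)}

/-- The vertices of the pile of cubes: the integer points of the box. -/
def pileVertices {d : ℕ} (lam : Fin d → ℕ) : Set (Fin d → ℝ) :=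
  {x | x ∈ box lam ∧ ∀ i, ∃ k : ℤ, x i = (k : ℝ)}

/-- The lifted pile of cubes: the convex hull of the points `(x, x_1^2 + ... + x_d^2)`, where `x`
runs through the vertices of the pile of cubes. -/
def liftedPile {d : ℕ} (lam : Fin d → ℕ) : Set (Space d) :=
  convexHull ℝ ((fun x : Fin d → ℝ => ((x, ∑ i, x i ^ 2) : Space d)) '' pileVertices lam)

/-- The linear functional `π(x) = x_1 + ... + x_d` on `ℝ^{d+1}` (the last coordinate is ignored). -/
def coordSum (d : ℕ) : Space d →ₗ[ℝ] ℝ :=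
  (∑ i, LinearMap.proj i) ∘ₗ LinearMap.fst ℝ (Fin d → ℝ) ℝ

/-- `γ` is a section of the projection `p : P → p(P)`: a continuous map from the segment `p(P)`
to `P` with `p ∘ γ = id`. Only the values of `γ` on `p(P)` matter. -/
def IsSection {E : Type*} [NormedAddCommGroup E] [NormedSpace ℝ E]
    (P : Set E) (p : E →ₗ[ℝ] ℝ) (γ : ℝ → E) : Prop :=
  ContinuousOn γ (p '' P) ∧ ∀ t ∈ p '' P, γ t ∈ P ∧ p (γ t) = t

/-- The monotone path polytope of `p : P → Q = p(P)`, that is, the fiber polytope in the case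
of a one-dimensional `Q`: the set of the averages `(1 / vol Q) ∫_Q γ` of the sections `γ`. -/
def monotonePathPolytope {E : Type*} [NormedAddCommGroup E] [NormedSpace ℝ E]
    (P : Set E) (p : E →ₗ[ℝ] ℝ) : Set E :=
  {z | ∃ γ : ℝ → E, IsSection P p γ ∧
    z = (MeasureTheory.volume.real (p '' P))⁻¹ • ∫ t in p '' P, γ t}

/-- The polytope `Π_d(lam)`. -/
def pathPolytope {d : ℕ} (lam : Fin d → ℕ) : Set (Space d) :=
  monotonePathPolytope (liftedPile lam) (coordSum d)

/-- The (nonempty) lower faces of a polytope `P` in `ℝ^{d+1}`: the faces on which some linear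
functional with positive last coefficient attains its minimum over `P`. As a subtype of
`Set (Space d)` this is partially ordered by inclusion. -/
def lowerFaces {d : ℕ} (P : Set (Space d)) : Set (Set (Space d)) :=
  {F | F.Nonempty ∧ ∃ c : Space d →ₗ[ℝ] ℝ, 0 < c (0, 1) ∧ F = {x | x ∈ P ∧ ∀ y ∈ P, c x ≤ c y}}

/-- The lower vertices of `P`: the points that form a lower face by themselves. -/
def lowerVertices {d : ℕ} (P : Set (Space d)) : Set (Space d) :=
  {v | {v} ∈ lowerFaces P}

/-- The arrangement `A_d(lam)` of the hyperplanes `x_i - x_j = s` in `ℝ^d`, for `i < j` and integers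
`s` with `-lam_i + 1 ≤ s ≤ lam_j - 1`. -/
def deformedBraid {d : ℕ} (lam : Fin d → ℕ) : Set (Set (Fin d → ℝ)) :=
  {H | ∃ i j : Fin d, i < j ∧ ∃ s : ℤ, -(lam i : ℤ) + 1 ≤ s ∧ s ≤ (lam j : ℤ) - 1 ∧
    H = {x | x i - x j = (s : ℝ)}}

/-- The regions of an arrangement: the connected components of the complement of the union of
its hyperplanes. -/
def regions {V : Type*} [TopologicalSpace V] (A : Set (Set V)) : Set (Set V) :=
  {R | ∃ x ∈ (⋃₀ A)ᶜ, R = connectedComponentIn (⋃₀ A)ᶜ x}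

/-- The normal vector `e_i - e_j - s e_{d+1}` of the hyperplane `x_i - x_j = s x_{d+1}`, which is the
homogenization of the hyperplane `x_i - x_j = s`. -/
def coneNormal {d : ℕ} (i j : Fin d) (s : ℤ) : Space d :=
  (Pi.single i 1 - Pi.single j 1, -(s : ℝ))

/-- The polar zonotope, associated to the cone of `A_d(lam)`: the Minkowski sum of the segments
`[-v_H, v_H]`, one for each hyperplane `H` of the cone, where `v_H` is a normal vector of `H`.
The hyperplanes are `x_{d+1} = 0`, with normal vector `w₀ e_{d+1}`, and the homogenizations
`x_i - x_j = s x_{d+1}` of the hyperplanes of `A_d(lam)`, with normal vectors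
`w i j s • (e_i - e_j - s e_{d+1})`. The numbers `w₀` and `w i j s` are nonzero and otherwise
arbitrary: they describe the choice of the normal vectors. -/
def polarZonotope {d : ℕ} (lam : Fin d → ℕ) (w₀ : ℝ) (w : Fin d → Fin d → ℤ → ℝ) :
    Set (Space d) :=
  segment ℝ (-(w₀ • ((0, 1) : Space d))) (w₀ • ((0, 1) : Space d)) +
    ∑ i : Fin d, ∑ j ∈ Finset.Ioi i, ∑ s ∈ Finset.Icc (-(lam i : ℤ) + 1) ((lam j : ℤ) - 1),
      segment ℝ (-(w i j s • coneNormal i j s)) (w i j s • coneNormal i j s)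

end MonotonePath

end

/-! Minimizing a functional `c` with positive last coefficient on a fiber of `π` is a fractional
knapsack problem: the cost of the step `k → k + 1` in the direction `i` is `c` of `(e_i, 2k + 1)`,
which increases with `k`, so the section of `π` that performs all `n` steps in the order of
increasing costs minimizes `c` on every fiber. Integrating the costs along this section gives the
minimum of `c` on `Π_d(lam)`: up to a linear term in `c`, it is `-1 / (4 n)` times the sum of
`|c(p) - c(q)|` over all pairs of steps `p, q`. These are the minima of a zonotope generated by the
differences of the steps. Differences `(e_i - e_j, 2 (k - l))` with `i ≠ j` are, after the last
coefficient is scaled by `1 / 2`, the normal vectors of the hyperplanes of the cone of `A_d(lam)`,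
and those with `i = j` have constant sign on lower functionals. Inclusions of faces of both
complexes are therefore governed by the same signs, which also tell the regions apart. -/

noncomputable section

namespace MonotonePath

open Filter MeasureTheory Module Topology

section SignLE

/-- The conformal order of signs, in which `0` lies below `-` and `+`: the sign of `y` is `0` or the
sign of `x`. -/
def SignLE (y x : ℝ) : Prop := (0 ≤ x → 0 ≤ y) ∧ (x ≤ 0 → y ≤ 0)

theorem SignLE.refl (x : ℝ) : SignLE x x := ⟨id, id⟩

theorem SignLE.of_mul_pos {x y : ℝ} (h : 0 < x * y) : SignLE y x :=
  ⟨fun hx => (pos_of_mul_pos_right h hx).le, fun hx => (neg_of_mul_pos_right h hx).le⟩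

theorem SignLE.eq_zero {y : ℝ} (h : SignLE y 0) : y = 0 :=
  le_antisymm (h.2 le_rfl) (h.1 le_rfl)

theorem signLE_iff_mul_pos {x y : ℝ} (hy : y ≠ 0) : SignLE y x ↔ 0 < x * y := by
  refine ⟨fun h => ?_, SignLE.of_mul_pos⟩
  rcases lt_trichotomy x 0 with hx | rfl | hx
  · exact mul_pos_of_neg_of_neg hx ((h.2 hx.le).lt_of_ne hy)
  · exact absurd h.eq_zero hy
  · exact mul_pos hx ((h.1 hx.le).lt_of_ne' hy)

theorem signLE_neg_iff {x y : ℝ} : SignLE (-y) (-x) ↔ SignLE y x := by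
  simp only [SignLE, Left.nonneg_neg_iff, Left.neg_nonpos_iff, and_comm]

theorem signLE_mul_left_iff {r : ℝ} (hr : r ≠ 0) {x y : ℝ} :
    SignLE (r * y) (r * x) ↔ SignLE y x := by
  have hpos : ∀ {r : ℝ}, 0 < r → (SignLE (r * y) (r * x) ↔ SignLE y x) := fun hr => by
    simp only [SignLE, mul_nonneg_iff_of_pos_left hr, mul_nonpos_iff_pos_imp_nonpos, hr, hr.le,
      true_imp_iff, imp_true_iff, and_true]
  rcases hr.lt_or_gt with hr | hr
  · rw [← hpos (neg_pos.2 hr), neg_mul, neg_mul, signLE_neg_iff]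
  · exact hpos hr

theorem eventually_mul_add_mul_pos {x : ℝ} (hx : x ≠ 0) (z : ℝ) :
    ∀ᶠ ε in 𝓝[>] (0 : ℝ), 0 < x * (x + ε * z) := by
  have hcont : Continuous fun ε : ℝ => x * (x + ε * z) := by fun_prop
  exact nhdsWithin_le_nhds (hcont.continuousAt.eventually
    (lt_mem_nhds (by simpa using mul_self_pos.2 hx)))

theorem eventually_signLE_add_mul (x z : ℝ) : ∀ᶠ ε in 𝓝[>] (0 : ℝ), SignLE x (x + ε * z) := by
  rcases eq_or_ne x 0 with rfl | hx
  · exact .of_forall fun ε => ⟨fun _ => le_rfl, fun _ => le_rfl⟩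
  · filter_upwards [eventually_mul_add_mul_pos hx z] with ε hε
    exact .of_mul_pos (by rwa [mul_comm])

theorem SignLE.eventually_abs_add_mul {x y : ℝ} (h : SignLE y x) :
    ∀ᶠ ε in 𝓝[>] (0 : ℝ), |x + ε * (x - y)| + ε * |y| = (1 + ε) * |x| := by
  rcases lt_trichotomy x 0 with hx | rfl | hx
  · filter_upwards [eventually_mul_add_mul_pos hx.ne (x - y)] with ε hε
    rw [abs_of_neg (neg_of_mul_pos_right hε hx.le), abs_of_nonpos (h.2 hx.le), abs_of_neg hx]
    ring
  · simp [h.eq_zero]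
  · filter_upwards [eventually_mul_add_mul_pos hx.ne' (x - y)] with ε hε
    rw [abs_of_pos (pos_of_mul_pos_right hε hx.le), abs_of_nonneg (h.1 hx.le), abs_of_pos hx]
    ring

theorem abs_prolong_add {ε : ℝ} (hε : 0 < ε) (x y : ℝ) :
    |x + ε * (x - y) + ε * y| = (1 + ε) * |x| := by
  rw [show x + ε * (x - y) + ε * y = (1 + ε) * x by ring, abs_mul, abs_of_pos (by positivity)]

theorem one_add_mul_abs_le {ε : ℝ} (hε : 0 < ε) (x y : ℝ) :
    (1 + ε) * |x| ≤ |x + ε * (x - y)| + ε * |y| := by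
  rw [← abs_prolong_add hε x y]
  exact (abs_add_le _ _).trans_eq (by rw [abs_mul, abs_of_pos hε])

theorem SignLE.of_abs_add_mul {ε x y : ℝ} (hε : 0 < ε)
    (h : |x + ε * (x - y)| + ε * |y| = (1 + ε) * |x|) : SignLE y x := by
  have hsame : |x + ε * (x - y) + ε * y| = |x + ε * (x - y)| + |ε * y| := by
    rw [abs_prolong_add hε, ← h, abs_mul ε, abs_of_pos hε]
  rcases abs_add_eq_add_abs_iff _ _ |>.1 hsame with ⟨h₁, h₂⟩ | ⟨h₁, h₂⟩ <;>
  constructor <;> intro hx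
  · exact nonneg_of_mul_nonneg_right h₂ hε
  · nlinarith
  · nlinarith
  · exact nonpos_of_mul_nonpos_right h₂ hε

end SignLE

section Faces

variable {E ι : Type*} [AddCommGroup E] [Module ℝ E]

/-- The face of `P` on which the linear functional `c` attains its minimum. -/
def face (c : E →ₗ[ℝ] ℝ) (P : Set E) : Set E := {x | x ∈ P ∧ ∀ y ∈ P, c x ≤ c y}

theorem mem_face_iff {c : E →ₗ[ℝ] ℝ} {P : Set E} {m : ℝ} (hm : IsLeast (c '' P) m) {x : E} :
    x ∈ face c P ↔ x ∈ P ∧ c x ≤ m := by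
  obtain ⟨z, hz, rfl⟩ := hm.1
  exact and_congr_right fun _ => ⟨fun h => h z hz, fun h y hy => h.trans (hm.2 ⟨y, hy, rfl⟩)⟩

theorem face_smul {r : ℝ} (hr : 0 < r) (c : E →ₗ[ℝ] ℝ) (P : Set E) :
    face (r • c) P = face c P := by
  simp only [face, LinearMap.smul_apply, smul_eq_mul, mul_le_mul_iff_right₀ hr]

/-- Every point of `C` is interior to `C` along each line through it. -/
def IsAlgebraicallyOpen {V : Type*} [AddCommGroup V] [Module ℝ V] (C : Set V) : Prop :=
  ∀ c ∈ C, ∀ u, ∀ᶠ ε in 𝓝[>] (0 : ℝ), c + ε • u ∈ C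

/-- The functionals in `C` have the same minima on `P` as on some translate of the zonotope
`∑ h ∈ T, [-v h, v h]`. The faces of `P` defined by these functionals are then those of a zonotope,
even if `P` is neither convex nor closed. -/
def IsZonotopalOn (C : Set (E →ₗ[ℝ] ℝ)) (P : Set E) (T : Finset ι) (v : ι → E) : Prop :=
  ∃ v₀, ∀ c ∈ C, IsLeast (c '' P) (c v₀ - ∑ h ∈ T, |c (v h)|)

namespace IsZonotopalOn

variable {C : Set (E →ₗ[ℝ] ℝ)} {P : Set E} {T : Finset ι} {v : ι → E} {c c' : E →ₗ[ℝ] ℝ}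

theorem face_nonempty (hP : IsZonotopalOn C P T v) (hc : c ∈ C) : (face c P).Nonempty := by
  obtain ⟨v₀, hmin⟩ := hP
  obtain ⟨x, hx, hxm⟩ := (hmin c hc).1
  exact ⟨x, (mem_face_iff (hmin c hc)).2 ⟨hx, hxm.le⟩⟩

-- The minimum is an affine function of the functional on the segment from `c'` to
-- `c + ε • (c - c')`, a slight prolongation of the segment from `c'` to `c`.
theorem face_subset_of_signLE (hP : IsZonotopalOn C P T v) (hC : IsAlgebraicallyOpen C)
    (hc : c ∈ C) (hc' : c' ∈ C) (h : ∀ i ∈ T, SignLE (c' (v i)) (c (v i))) :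
    face c P ⊆ face c' P := by
  obtain ⟨v₀, hmin⟩ := hP
  obtain ⟨ε, ⟨habs, hmem⟩, hε : 0 < ε⟩ :=
    (((T.eventually_all.2 fun i hi => (h i hi).eventually_abs_add_mul).and
      (hC c hc (c - c'))).and self_mem_nhdsWithin).exists
  have hsum : ∑ i ∈ T, |(c + ε • (c - c')) (v i)| + ε * ∑ i ∈ T, |c' (v i)| =
      (1 + ε) * ∑ i ∈ T, |c (v i)| := by
    rw [Finset.mul_sum, Finset.mul_sum, ← Finset.sum_add_distrib]
    exact Finset.sum_congr rfl habs
  intro x hx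
  rw [mem_face_iff (hmin c hc)] at hx
  rw [mem_face_iff (hmin c' hc')]
  refine ⟨hx.1, le_of_mul_le_mul_left ?_ hε⟩
  have hlow := (hmin _ hmem).2 ⟨x, hx.1, rfl⟩
  simp only [LinearMap.add_apply, LinearMap.smul_apply, LinearMap.sub_apply, smul_eq_mul]
    at hlow hsum
  nlinarith [mul_le_mul_of_nonneg_left hx.2 (by positivity : 0 ≤ 1 + ε)]

theorem eventually_face_add_smul_subset (hP : IsZonotopalOn C P T v) (hC : IsAlgebraicallyOpen C)
    (hc : c ∈ C) (u : E →ₗ[ℝ] ℝ) : ∀ᶠ ε in 𝓝[>] (0 : ℝ), face (c + ε • u) P ⊆ face c P := by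
  filter_upwards [hC c hc u, T.eventually_all.2 fun i _ =>
    eventually_signLE_add_mul (c (v i)) (u (v i))] with ε hmem hsign
  exact hP.face_subset_of_signLE hC hmem hc hsign

theorem signLE_of_face_subset (hP : IsZonotopalOn C P T v) (hC : IsAlgebraicallyOpen C)
    (hc : c ∈ C) (hc' : c' ∈ C) (h : face c P ⊆ face c' P) :
    ∀ i ∈ T, SignLE (c' (v i)) (c (v i)) := by
  obtain ⟨ε, ⟨hsub, hmem⟩, hε : 0 < ε⟩ :=
    (((hP.eventually_face_add_smul_subset hC hc (c - c')).and
      (hC c hc (c - c'))).and self_mem_nhdsWithin).exists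
  obtain ⟨x, hx⟩ := hP.face_nonempty hmem
  obtain ⟨v₀, hmin⟩ := hP
  have hval : ∀ {e : E →ₗ[ℝ] ℝ}, e ∈ C → x ∈ face e P → e x = e v₀ - ∑ i ∈ T, |e (v i)| :=
    fun he hxe => le_antisymm ((mem_face_iff (hmin _ he)).1 hxe).2 ((hmin _ he).2 ⟨x, hxe.1, rfl⟩)
  have hsum : ∑ i ∈ T, (1 + ε) * |c (v i)| =
      ∑ i ∈ T, (|c (v i) + ε * (c (v i) - c' (v i))| + ε * |c' (v i)|) := by
    have h₁ := hval hmem hx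
    have h₂ := hval hc (hsub hx)
    have h₃ := hval hc' (h (hsub hx))
    simp only [LinearMap.add_apply, LinearMap.smul_apply, LinearMap.sub_apply, smul_eq_mul] at h₁
    rw [Finset.sum_add_distrib, ← Finset.mul_sum, ← Finset.mul_sum]
    linear_combination (-1 : ℝ) * h₁ + (1 + ε) * h₂ - ε * h₃
  have hterm := (Finset.sum_eq_sum_iff_of_le fun i _ =>
    one_add_mul_abs_le hε (c (v i)) (c' (v i))).1 hsum
  exact fun i hi => .of_abs_add_mul hε (hterm i hi).symm

theorem face_subset_face_iff (hP : IsZonotopalOn C P T v) (hC : IsAlgebraicallyOpen C)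
    (hc : c ∈ C) (hc' : c' ∈ C) :
    face c P ⊆ face c' P ↔ ∀ i ∈ T, SignLE (c' (v i)) (c (v i)) :=
  ⟨hP.signLE_of_face_subset hC hc hc', hP.face_subset_of_signLE hC hc hc'⟩

theorem exists_face_eq_singleton_iff (hP : IsZonotopalOn C P T v) (hC : IsAlgebraicallyOpen C)
    (hc : c ∈ C) : (∃ z, face c P = {z}) ↔ ∀ i ∈ T, c (v i) = 0 → v i = 0 := by
  constructor
  · rintro ⟨z, hz⟩ i hi h₀
    refine (forall_dual_apply_eq_zero_iff ℝ (v i)).1 fun u => ?_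
    obtain ⟨ε, ⟨hsub, hmem⟩, hε : 0 < ε⟩ := (((hP.eventually_face_add_smul_subset hC hc u).and
      (hC c hc u)).and self_mem_nhdsWithin).exists
    rw [hz, (hP.face_nonempty hmem).subset_singleton_iff] at hsub
    have hsign := hP.signLE_of_face_subset hC hc hmem (hz.trans hsub.symm).subset i hi
    rw [h₀] at hsign
    simpa [h₀, hε.ne'] using hsign.eq_zero
  · intro h
    obtain ⟨z, hz⟩ := hP.face_nonempty hc
    refine ⟨z, Set.eq_singleton_iff_unique_mem.2 ⟨hz, fun y hy => sub_eq_zero.1 ?_⟩⟩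
    refine (forall_dual_apply_eq_zero_iff ℝ (y - z)).1 fun u => ?_
    have hsign : ∀ᶠ ε in 𝓝[>] (0 : ℝ), ∀ i ∈ T, SignLE ((c + ε • u) (v i)) (c (v i)) := by
      refine T.eventually_all.2 fun i hi => ?_
      by_cases h₀ : c (v i) = 0
      · exact .of_forall fun ε => by simpa [h i hi h₀] using SignLE.refl 0
      · exact (eventually_mul_add_mul_pos h₀ (u (v i))).mono fun ε => SignLE.of_mul_pos
    obtain ⟨ε, ⟨hsign, hmem⟩, hε : 0 < ε⟩ :=
      ((hsign.and (hC c hc u)).and self_mem_nhdsWithin).exists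
    have hsub := hP.face_subset_of_signLE hC hc hmem hsign
    have heq : c y = c z := le_antisymm (hy.2 z hz.1) (hz.2 y hy.1)
    have heq' := le_antisymm ((hsub hy).2 z hz.1) ((hsub hz).2 y hy.1)
    simp only [LinearMap.add_apply, LinearMap.smul_apply, smul_eq_mul, heq, add_right_inj,
      mul_right_inj' hε.ne'] at heq'
    rw [map_sub, heq', sub_self]

end IsZonotopalOn

theorem isLeast_image_segment_neg (c : E →ₗ[ℝ] ℝ) (v : E) :
    IsLeast (c '' segment ℝ (-v) v) (-|c v|) := by
  have himage : c '' segment ℝ (-v) v = Set.uIcc (-c v) (c v) := by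
    rw [← LinearMap.coe_toAffineMap, image_segment, segment_eq_uIcc, LinearMap.coe_toAffineMap,
      map_neg]
  rw [himage, abs_eq_max_neg, ← min_neg_neg, neg_neg]
  exact isLeast_Icc inf_le_sup

theorem isLeast_finsetSum {T : Finset ι} {S : ι → Set ℝ} {m : ι → ℝ}
    (h : ∀ i ∈ T, IsLeast (S i) (m i)) : IsLeast (∑ i ∈ T, S i) (∑ i ∈ T, m i) := by
  refine ⟨Set.finsetSum_mem_finsetSum _ _ _ fun i hi => (h i hi).1, fun x hx => ?_⟩
  obtain ⟨g, hg, rfl⟩ := (Set.mem_finsetSum _ _ _).1 hx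
  exact Finset.sum_le_sum fun i hi => (h i hi).2 (hg hi)

theorem isZonotopalOn_zonotope (T : Finset ι) (v : ι → E) :
    IsZonotopalOn Set.univ (∑ h ∈ T, segment ℝ (-v h) (v h)) T v := by
  refine ⟨0, fun c _ => ?_⟩
  rw [map_zero, zero_sub, ← Finset.sum_neg_distrib, Set.image_finsetSum]
  exact isLeast_finsetSum fun h _ => isLeast_image_segment_neg c (v h)

end Faces

section MonotonePathPolytope

theorem isLeast_image_monotonePathPolytope {E : Type*} [NormedAddCommGroup E] [NormedSpace ℝ E]
    [CompleteSpace E] {P : Set E} {p : E →ₗ[ℝ] ℝ} (hcompact : IsCompact (p '' P)) {γ : ℝ → E}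
    (hγ : IsSection P p γ) (c : E →L[ℝ] ℝ) (hmin : ∀ x ∈ P, c (γ (p x)) ≤ c x) :
    IsLeast (c '' monotonePathPolytope P p)
      ((volume.real (p '' P))⁻¹ * ∫ t in p '' P, c (γ t)) := by
  have hval : ∀ {δ : ℝ → E}, IsSection P p δ → c ((volume.real (p '' P))⁻¹ • ∫ t in p '' P, δ t) =
      (volume.real (p '' P))⁻¹ * ∫ t in p '' P, c (δ t) := fun hδ => by
    rw [map_smul, smul_eq_mul, c.integral_comp_comm (hδ.1.integrableOn_compact hcompact)]
  refine ⟨⟨_, ⟨γ, hγ, rfl⟩, hval hγ⟩, ?_⟩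
  rintro _ ⟨_, ⟨δ, hδ, rfl⟩, rfl⟩
  rw [hval hδ]
  refine mul_le_mul_of_nonneg_left ?_ (by positivity)
  refine setIntegral_mono_on (c.integrable_comp (hγ.1.integrableOn_compact hcompact))
    (c.integrable_comp (hδ.1.integrableOn_compact hcompact)) hcompact.measurableSet fun t ht => ?_
  simpa only [(hδ.2 t ht).2] using hmin (δ t) (hδ.2 t ht).1

end MonotonePathPolytope

section StepPath

/-- The piecewise linear function that is `0` up to `0`, and `1` from `1` on. -/
def ramp (x : ℝ) : ℝ := max 0 (min 1 x)

theorem continuous_ramp : Continuous ramp := by unfold ramp; fun_prop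

theorem ramp_of_nonpos {x : ℝ} (hx : x ≤ 0) : ramp x = 0 :=
  max_eq_left ((min_le_right _ _).trans hx)

theorem ramp_of_one_le {x : ℝ} (hx : 1 ≤ x) : ramp x = 1 := by
  rw [ramp, min_eq_left hx, max_eq_right zero_le_one]

theorem ramp_of_mem_Icc {x : ℝ} (hx : x ∈ Set.Icc 0 1) : ramp x = x := by
  rw [ramp, min_eq_right hx.2, max_eq_right hx.1]

theorem integral_ramp {a b : ℝ} (ha : a ≤ 0) (hb : 1 ≤ b) :
    ∫ x in a..b, ramp x = b - 1 / 2 := by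
  have hint (u v : ℝ) : IntervalIntegrable ramp volume u v := continuous_ramp.intervalIntegrable u v
  have hleft : ∫ x in a..0, ramp x = 0 := by
    refine intervalIntegral.integral_zero_ae (.of_forall fun x hx => ramp_of_nonpos ?_)
    exact (Set.uIoc_of_le ha ▸ hx).2
  have hmid : ∫ x in (0 : ℝ)..1, ramp x = 1 / 2 := by
    rw [intervalIntegral.integral_congr fun x hx =>
      ramp_of_mem_Icc (Set.uIcc_of_le (zero_le_one' ℝ) ▸ hx), integral_id]
    norm_num
  have hright : ∫ x in (1 : ℝ)..b, ramp x = b - 1 := by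
    rw [intervalIntegral.integral_congr (g := fun _ => 1) fun x hx =>
      ramp_of_one_le (Set.uIcc_of_le hb ▸ hx).1]
    simp
  rw [← intervalIntegral.integral_add_adjacent_intervals (hint a 0) (hint 0 b),
    ← intervalIntegral.integral_add_adjacent_intervals (hint 0 1) (hint 1 b), hleft, hmid, hright]
  ring

variable {n : ℕ} {E : Type*} [AddCommGroup E] [Module ℝ E]

/-- The path that starts at `0` and performs the steps `w 0`, …, `w (n - 1)` one after the other,
each at constant velocity and in one unit of time. -/
def stepPath (w : Fin n → E) (t : ℝ) : E := ∑ s : Fin n, ramp (t - (s : ℕ)) • w s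

theorem map_stepPath {F : Type*} [AddCommGroup F] [Module ℝ F] (f : E →ₗ[ℝ] F) (w : Fin n → E)
    (t : ℝ) : f (stepPath w t) = stepPath (f ∘ w) t := by
  simp only [stepPath, map_sum, map_smul, Function.comp_apply]

theorem continuous_stepPath {E : Type*} [NormedAddCommGroup E] [NormedSpace ℝ E] (w : Fin n → E) :
    Continuous (stepPath w) :=
  continuous_finsetSum _ fun s _ =>
    (continuous_ramp.comp (continuous_sub_right (s : ℝ))).smul continuous_const

theorem ramp_sub_natCast {t : ℝ} (ht : 0 ≤ t) (s : ℕ) :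
    ramp (t - s) = (1 - Int.fract t) * (if s < ⌊t⌋₊ then 1 else 0) +
      Int.fract t * (if s < ⌊t⌋₊ + 1 then 1 else 0) := by
  have hfract : Int.fract t = t - ⌊t⌋₊ := by
    rw [Int.fract, ← natCast_floor_eq_intCast_floor ht]
  rcases lt_trichotomy s ⌊t⌋₊ with h | h | h
  · have : ((s + 1 : ℕ) : ℝ) ≤ t := (Nat.le_floor_iff ht).1 h
    push_cast at this
    rw [ramp_of_one_le (by linarith), if_pos h, if_pos (by omega)]
    ring
  · have hle := Nat.floor_le ht
    have hlt := Nat.lt_floor_add_one t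
    subst h
    rw [ramp_of_mem_Icc ⟨by linarith, by linarith⟩, if_neg (lt_irrefl _),
      if_pos (Nat.lt_succ_self _), hfract]
    ring
  · have : t < s := (Nat.floor_lt ht).1 h
    rw [ramp_of_nonpos (by linarith), if_neg (by omega), if_neg (by omega)]
    ring

theorem stepPath_mem {P : Set E} (hP : Convex ℝ P) {w : Fin n → E}
    (hw : ∀ m : ℕ, ∑ s : Fin n with s.val < m, w s ∈ P) {t : ℝ} (ht : 0 ≤ t) :
    stepPath w t ∈ P := by
  have hsplit : stepPath w t = (1 - Int.fract t) • ∑ s : Fin n with s.val < ⌊t⌋₊, w s +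
      Int.fract t • ∑ s : Fin n with s.val < ⌊t⌋₊ + 1, w s := by
    simp only [stepPath, ramp_sub_natCast ht, add_smul, mul_smul, Finset.sum_add_distrib,
      ← Finset.smul_sum, Finset.sum_filter, ite_smul, one_smul, zero_smul]
  rw [hsplit]
  exact hP (hw _) (hw _) (sub_nonneg.2 (Int.fract_lt_one t).le) (Int.fract_nonneg t) (by ring)

theorem sum_ramp (n : ℕ) (t : ℝ) : ∑ s : Fin n, ramp (t - (s : ℕ)) = max 0 (min (n : ℝ) t) := by
  induction n with
  | zero => simp
  | succ n ih =>
    have hn : (0 : ℝ) ≤ n := n.cast_nonneg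
    simp only [Fin.sum_univ_castSucc, Fin.val_castSucc, ih, Fin.val_last]
    rw [ramp]
    push_cast
    grind

-- The greedy solution of a fractional knapsack problem.
theorem stepPath_sum_le {f : Fin n → ℝ} (hf : Monotone f) {y : Fin n → ℝ}
    (hy : ∀ s, y s ∈ Set.Icc 0 1) : stepPath f (∑ s, y s) ≤ ∑ s, y s * f s := by
  rcases n.eq_zero_or_pos with rfl | hn
  · simp [stepPath]
  set t := ∑ s, y s with ht_def
  have ht₀ : 0 ≤ t := Finset.sum_nonneg fun s _ => (hy s).1
  have htn : t ≤ n := by simpa using Finset.sum_le_sum fun s (_ : s ∈ Finset.univ) => (hy s).2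
  have hceil : ⌈t⌉₊ ≤ n := Nat.ceil_le.2 htn
  let r : Fin n := ⟨⌈t⌉₊ - 1, by omega⟩
  have hterm (s : Fin n) : 0 ≤ (y s - ramp (t - (s : ℕ))) * (f s - f r) := by
    rcases lt_trichotomy s r with hs | rfl | hs
    · have hst : ((s + 1 : ℕ) : ℝ) < t := Nat.lt_ceil.1 (by have := Fin.lt_def.1 hs; grind)
      push_cast at hst
      rw [ramp_of_one_le (by linarith)]
      exact mul_nonneg_of_nonpos_of_nonpos (sub_nonpos.2 (hy s).2) (sub_nonpos.2 (hf hs.le))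
    · simp
    · have hst : t ≤ s := Nat.ceil_le.1 (by have := Fin.lt_def.1 hs; grind)
      rw [ramp_of_nonpos (by linarith), sub_zero]
      exact mul_nonneg (hy s).1 (sub_nonneg.2 (hf hs.le))
  have hsum := Finset.sum_nonneg fun s (_ : s ∈ Finset.univ) => hterm s
  have hramp : ∑ s : Fin n, ramp (t - (s : ℕ)) = t := by
    rw [sum_ramp, min_eq_right htn, max_eq_right ht₀]
  simp only [mul_sub, sub_mul, Finset.sum_sub_distrib, ← Finset.sum_mul, hramp, ← ht_def, sub_self,
    sub_zero] at hsum
  simpa only [stepPath, smul_eq_mul] using sub_nonneg.1 hsum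

theorem sum_abs_sub_of_monotone {f : Fin n → ℝ} (hf : Monotone f) :
    ∑ s, ∑ s', |f s - f s'| = 2 * ∑ s : Fin n, (2 * (s : ℕ) + 1 - n) * f s := by
  induction n with
  | zero => simp
  | succ n ih =>
    have hlast (s : Fin n) : |f s.castSucc - f (Fin.last n)| = f (Fin.last n) - f s.castSucc := by
      rw [abs_sub_comm, abs_of_nonneg (sub_nonneg.2 (hf (Fin.le_last _)))]
    have hind := ih (f := fun s => f s.castSucc) fun s s' h => hf (Fin.castSucc_le_castSucc_iff.2 h)
    simp only [Fin.sum_univ_castSucc, Finset.sum_add_distrib, hind, abs_sub_comm (f (Fin.last n)),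
      hlast, Finset.sum_sub_distrib, Finset.mul_sum, Fin.val_castSucc, Fin.val_last]
    simp only [← Finset.mul_sum, sub_mul, add_mul, Finset.sum_sub_distrib, Finset.sum_add_distrib,
      mul_assoc, sub_self, abs_zero, Finset.sum_const, Finset.card_univ, Fintype.card_fin,
      nsmul_eq_mul]
    push_cast
    ring

theorem integral_stepPath {α : Type*} [Fintype α] (e : Fin n ≃ α) {f : α → ℝ}
    (hf : Monotone (f ∘ e)) :
    ∫ t in (0 : ℝ)..n, stepPath (f ∘ e) t = n / 2 * ∑ p, f p - 1 / 4 * ∑ p, ∑ q, |f p - f q| := by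
  have hramp (s : Fin n) : ∫ t in (0 : ℝ)..n, ramp (t - (s : ℕ)) = n - (s : ℕ) - 1 / 2 := by
    have hs : ((s + 1 : ℕ) : ℝ) ≤ n := Nat.cast_le.2 s.isLt
    push_cast at hs
    rw [intervalIntegral.integral_comp_sub_right ramp, integral_ramp (by simp) (by linarith)]
  have hint (s : Fin n) :
      IntervalIntegrable (fun t => ramp (t - (s : ℕ)) * f (e s)) volume 0 n :=
    ((continuous_ramp.comp (continuous_sub_right (s : ℝ))).mul
      continuous_const).intervalIntegrable _ _
  have habs : ∑ p, ∑ q, |f p - f q| = ∑ s, ∑ s', |(f ∘ e) s - (f ∘ e) s'| := by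
    simp only [← e.sum_comp, Function.comp_apply]
  simp only [stepPath, smul_eq_mul, Function.comp_apply]
  rw [intervalIntegral.integral_finsetSum fun s _ => hint s, habs, sum_abs_sub_of_monotone hf,
    ← e.sum_comp f, Finset.mul_sum, Finset.mul_sum, Finset.mul_sum, ← Finset.sum_sub_distrib]
  refine Finset.sum_congr rfl fun s _ => ?_
  rw [intervalIntegral.integral_mul_const, hramp, Function.comp_apply]
  ring

end StepPath

section Steps

variable {d : ℕ} {lam : Fin d → ℕ}

/-- The unit steps of the monotone lattice paths in the box: the step `⟨i, k⟩` increases the `i`-th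
coordinate from `k` to `k + 1`. Steps are comparable only if they have the same direction `i`. -/
abbrev Step (lam : Fin d → ℕ) : Type := Σ i, Fin (lam i)

/-- The increment of the lifted point `(x, x_1^2 + ... + x_d^2)` in a step: the last entry is
`(k + 1)^2 - k^2`. -/
def stepVector (p : Step lam) : Space d := (Pi.single p.1 1, 2 * (p.2 : ℕ) + 1)

theorem coordSum_stepVector (p : Step lam) : coordSum d (stepVector p) = 1 := by
  simp [coordSum, stepVector]

theorem sum_stepVector_of_lt {v : Fin d → ℕ} (hv : ∀ i, v i ≤ lam i) :
    ∑ p : Step lam with p.2.val < v p.1, stepVector p =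
      ((fun i => (v i : ℝ)), ∑ i, (v i : ℝ) ^ 2) := by
  have hodd (m : ℕ) : ∑ k ∈ Finset.range m, (2 * (k : ℝ) + 1) = (m : ℝ) ^ 2 := by
    induction m with
    | zero => simp
    | succ m ih => rw [Finset.sum_range_succ, ih]; push_cast; ring
  have hfiber (i : Fin d) : (∑ k : Fin (lam i), if k.val < v i then stepVector ⟨i, k⟩ else 0) =
      ((Pi.single i (v i), (v i : ℝ) ^ 2) : Space d) := by
    let g (k : ℕ) : Space d := (Pi.single i 1, 2 * k + 1)
    have hrange : ({k ∈ Finset.range (lam i) | k < v i} : Finset ℕ) = Finset.range (v i) := by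
      ext k
      simpa using fun hk => hk.trans_le (hv i)
    calc _ = ∑ k ∈ Finset.range (v i), g k := by
          rw [← hrange, Finset.sum_filter, ← Fin.sum_univ_eq_sum_range]
          rfl
      _ = _ := by
          ext j
          · simp [g, Prod.fst_sum, Pi.single_apply]
          · simp [g, Prod.snd_sum, hodd]
  rw [Finset.sum_filter, Fintype.sum_sigma]
  simp only [hfiber]
  ext i <;> simp [Prod.fst_sum, Prod.snd_sum, Finset.sum_apply, Pi.single_apply]

theorem exists_bound_of_isLowerSet {S : Set (Step lam)} (hS : IsLowerSet S) :
    ∃ v : Fin d → ℕ, (∀ i, v i ≤ lam i) ∧ ∀ p, p ∈ S ↔ p.2.val < v p.1 := by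
  have hfiber (i : Fin d) :
      ∃ m ≤ lam i, ∀ k : Fin (lam i), (⟨i, k⟩ : Step lam) ∈ S ↔ k.val < m := by
    have hlower : IsLowerSet {k : Fin (lam i) | (⟨i, k⟩ : Step lam) ∈ S} :=
      fun k l hlk => hS (Sigma.mk_le_mk_iff.2 hlk)
    obtain h | ⟨a, h⟩ := hlower.eq_univ_or_Iio <;> simp only [Set.ext_iff] at h
    · exact ⟨lam i, le_rfl, fun k => by simpa using h k⟩
    · exact ⟨a, a.is_lt.le, h⟩
  choose v hv hmem using hfiber
  exact ⟨v, hv, fun p => hmem p.1 p.2⟩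

theorem sum_stepVector_mem_liftedPile {S : Finset (Step lam)}
    (hS : IsLowerSet (S : Set (Step lam))) : ∑ p ∈ S, stepVector p ∈ liftedPile lam := by
  obtain ⟨v, hv, hmem⟩ := exists_bound_of_isLowerSet hS
  have hfilter : S = ({p | p.2.val < v p.1} : Finset (Step lam)) := by
    ext p
    simpa using hmem p
  rw [hfilter, sum_stepVector_of_lt hv]
  exact subset_convexHull _ _ ⟨_, ⟨fun i => ⟨by positivity, by exact_mod_cast hv i⟩,
    fun i => ⟨v i, by simp⟩⟩, rfl⟩

theorem exists_eq_sum_smul_stepVector {x : Space d} (hx : x ∈ liftedPile lam) :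
    ∃ y : Step lam → ℝ, (∀ p, y p ∈ Set.Icc 0 1) ∧ ∑ p, y p • stepVector p = x := by
  have hsub : liftedPile lam ⊆
      Fintype.linearCombination ℝ (stepVector (lam := lam)) '' Set.Icc 0 1 := by
    refine convexHull_min ?_ ((convex_Icc 0 1).linear_image _)
    rintro _ ⟨x, ⟨hbox, hint⟩, rfl⟩
    have hnat (i : Fin d) : ∃ m : ℕ, x i = m := by
      obtain ⟨k, hk⟩ := hint i
      lift k to ℕ using by exact_mod_cast hk ▸ (hbox i).1
      exact ⟨k, by simpa using hk⟩
    choose v hv using hnat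
    refine ⟨fun p => if p.2.val < v p.1 then 1 else 0, ⟨fun p => ?_, fun p => ?_⟩, ?_⟩
    · dsimp only; split_ifs <;> simp
    · dsimp only; split_ifs <;> simp
    · obtain rfl : x = fun i => (v i : ℝ) := funext hv
      have hle (i : Fin d) : v i ≤ lam i := Nat.cast_le.1 (hbox i).2
      simp [Fintype.linearCombination_apply, ← sum_stepVector_of_lt hle, Finset.sum_filter]
  obtain ⟨y, hy, rfl⟩ := hsub hx
  exact ⟨y, fun p => ⟨hy.1 p, hy.2 p⟩, Fintype.linearCombination_apply ..⟩

theorem coordSum_sum_smul_stepVector (y : Step lam → ℝ) :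
    coordSum d (∑ p, y p • stepVector p) = ∑ p, y p := by
  simp [coordSum_stepVector]

theorem card_step : Fintype.card (Step lam) = ∑ i, lam i := by
  simp

theorem coordSum_image_liftedPile (lam : Fin d → ℕ) :
    coordSum d '' liftedPile lam = Set.Icc 0 ((∑ i, lam i : ℕ) : ℝ) := by
  refine Set.Subset.antisymm ?_ ?_
  · rintro _ ⟨x, hx, rfl⟩
    obtain ⟨y, hy, rfl⟩ := exists_eq_sum_smul_stepVector hx
    rw [coordSum_sum_smul_stepVector, ← card_step (lam := lam)]
    exact ⟨Finset.sum_nonneg fun p _ => (hy p).1,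
      by simpa using Finset.sum_le_sum fun p (_ : p ∈ Finset.univ) => (hy p).2⟩
  · have hconvex : Convex ℝ (coordSum d '' liftedPile lam) := (convex_convexHull ℝ _).linear_image _
    refine hconvex.ordConnected.out ⟨_, sum_stepVector_mem_liftedPile (S := ∅) ?_, by simp⟩
      ⟨_, sum_stepVector_mem_liftedPile (S := Finset.univ) ?_, ?_⟩
    · simpa using isLowerSet_empty
    · simpa using isLowerSet_univ
    · simp [coordSum_stepVector]

theorem exists_equiv_fin_monotone {α : Type*} [Fintype α] {n : ℕ} (hα : Fintype.card α = n)
    (f : α → ℝ) : ∃ e : Fin n ≃ α, Monotone (f ∘ e) :=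
  let e := (Fintype.equivFinOfCardEq hα).symm
  ⟨(Tuple.sort (f ∘ e)).trans e, Tuple.monotone_sort (f ∘ e)⟩

/-- The linear functionals with positive last coefficient, whose faces are the lower faces. -/
def lowerFunctionals (d : ℕ) : Set (Space d →ₗ[ℝ] ℝ) := {c | 0 < c (0, 1)}

theorem isAlgebraicallyOpen_lowerFunctionals (d : ℕ) : IsAlgebraicallyOpen (lowerFunctionals d) :=
  fun _ hc u => (eventually_mul_add_mul_pos (ne_of_gt hc) (u (0, 1))).mono fun _ hε =>
    pos_of_mul_pos_right hε (le_of_lt hc)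

theorem strictMono_apply_stepVector {c : Space d →ₗ[ℝ] ℝ} (hc : c ∈ lowerFunctionals d) :
    StrictMono fun p : Step lam => c (stepVector p) := by
  have hcost (p : Step lam) : c (stepVector p) =
      c (Pi.single p.1 1, 0) + (2 * (p.2 : ℕ) + 1) * c (0, 1) := by
    rw [← smul_eq_mul, ← map_smul, ← map_add]
    simp [stepVector]
  rintro _ _ ⟨i, k, l, hkl⟩
  simp only [hcost]
  have hc : 0 < c (0, 1) := hc
  have hkl : (k.val : ℝ) < l.val := by exact_mod_cast hkl
  gcongr

theorem isSection_stepPath {e : Fin (∑ i, lam i) ≃ Step lam} (he : Monotone e.symm) :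
    IsSection (liftedPile lam) (coordSum d) (stepPath (stepVector ∘ e)) := by
  rw [IsSection, coordSum_image_liftedPile]
  refine ⟨(continuous_stepPath _).continuousOn, fun t ht => ⟨?_, ?_⟩⟩
  · refine stepPath_mem (convex_convexHull ℝ _) (fun m => ?_) ht.1
    have hlower : IsLowerSet (({p | (e.symm p).val < m} : Finset (Step lam)) : Set (Step lam)) :=
      fun p q hqp hp => by
        simp only [Finset.coe_filter, Finset.mem_univ, true_and, Set.mem_ofPred_eq] at hp ⊢
        exact (Fin.le_def.1 (he hqp)).trans_lt hp
    have hsum : ∑ s with s.val < m, (stepVector ∘ e) s =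
        ∑ p with (e.symm p).val < m, stepVector p :=
      Finset.sum_equiv e (by simp) fun _ _ => rfl
    exact hsum ▸ sum_stepVector_mem_liftedPile hlower
  · rw [map_stepPath]
    simp only [stepPath, Function.comp_apply, coordSum_stepVector, smul_eq_mul, mul_one, sum_ramp,
      min_eq_right ht.2, max_eq_right ht.1]

theorem stepPath_coordSum_le {e : Fin (∑ i, lam i) ≃ Step lam} {c : Space d →ₗ[ℝ] ℝ}
    (he : Monotone fun s => c (stepVector (e s))) {x : Space d} (hx : x ∈ liftedPile lam) :
    c (stepPath (stepVector ∘ e) (coordSum d x)) ≤ c x := by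
  obtain ⟨y, hy, rfl⟩ := exists_eq_sum_smul_stepVector hx
  rw [map_stepPath, coordSum_sum_smul_stepVector, ← e.sum_comp y, map_sum,
    ← e.sum_comp fun p => c (y p • stepVector p)]
  simp only [map_smul, smul_eq_mul]
  exact stepPath_sum_le he fun s => hy (e s)

/-- The generators of a zonotope of which `Π_d(lam)` has the lower faces. -/
def stepDifference (h : Step lam × Step lam) : Space d :=
  (4 * (∑ i, lam i : ℕ) : ℝ)⁻¹ • (stepVector h.1 - stepVector h.2)

theorem sum_abs_apply_stepDifference (c : Space d →ₗ[ℝ] ℝ) :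
    ∑ h : Step lam × Step lam, |c (stepDifference h)| =
      (4 * (∑ i, lam i : ℕ) : ℝ)⁻¹ * ∑ p : Step lam, ∑ q : Step lam,
        |c (stepVector p) - c (stepVector q)| := by
  simp only [stepDifference, map_smul, map_sub, smul_eq_mul, abs_mul, ← Finset.mul_sum,
    Fintype.sum_prod_type]
  rw [abs_of_nonneg (by positivity)]

-- A lower functional is minimized on the fibers of `coordSum` by the path that performs all steps
-- in the order of increasing costs: steps of the same direction have increasing costs.
theorem isZonotopalOn_pathPolytope (hn : 0 < ∑ i, lam i) :
    IsZonotopalOn (lowerFunctionals d) (pathPolytope lam) Finset.univ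
      (stepDifference (lam := lam)) := by
  refine ⟨(1 / 2 : ℝ) • ∑ p : Step lam, stepVector p, fun c hc => ?_⟩
  obtain ⟨e, he⟩ := exists_equiv_fin_monotone card_step fun p : Step lam => c (stepVector p)
  have hsymm : StrictMono e.symm := fun p q hpq =>
    he.reflect_lt (by simpa using strictMono_apply_stepVector hc hpq)
  have hleast := isLeast_image_monotonePathPolytope
    (coordSum_image_liftedPile lam ▸ isCompact_Icc) (isSection_stepPath hsymm.monotone)
    c.toContinuousLinearMap fun x hx => stepPath_coordSum_le he hx
  have hnℝ : ((∑ i, lam i : ℕ) : ℝ) ≠ 0 := Nat.cast_ne_zero.2 hn.ne'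
  have hintegral : ∫ t in Set.Icc (0 : ℝ) (∑ i, lam i : ℕ), c (stepPath (stepVector ∘ e) t) =
      (∑ i, lam i : ℕ) / 2 * ∑ p : Step lam, c (stepVector p) -
        1 / 4 * ∑ p : Step lam, ∑ q : Step lam, |c (stepVector p) - c (stepVector q)| := by
    rw [integral_Icc_eq_integral_Ioc, ← intervalIntegral.integral_of_le (Nat.cast_nonneg _)]
    simp only [map_stepPath]
    exact integral_stepPath e he
  convert hleast using 1
  · rfl
  rw [coordSum_image_liftedPile, Real.volume_real_Icc_of_le (Nat.cast_nonneg _), sub_zero,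
    sum_abs_apply_stepDifference, map_smul, map_sum, smul_eq_mul]
  simp only [LinearMap.coe_toContinuousLinearMap', hintegral]
  field_simp

end Steps

section Arrangement

variable {d : ℕ} {lam : Fin d → ℕ}

/-- The triples `⟨i, j, s⟩` that index the hyperplanes `x_i - x_j = s` of `A_d(lam)`. -/
def hyperplaneIndex (lam : Fin d → ℕ) : Finset (Σ _ : Fin d, Σ _ : Fin d, ℤ) :=
  Finset.univ.sigma fun i => (Finset.Ioi i).sigma fun j =>
    Finset.Icc (-(lam i : ℤ) + 1) ((lam j : ℤ) - 1)

theorem mem_hyperplaneIndex {i j : Fin d} {s : ℤ} : ⟨i, j, s⟩ ∈ hyperplaneIndex lam ↔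
    i < j ∧ -(lam i : ℤ) + 1 ≤ s ∧ s ≤ (lam j : ℤ) - 1 := by
  simp [hyperplaneIndex]

/-- The affine form `x_i - x_j - s`, which vanishes on the hyperplane with the index `⟨i, j, s⟩`. -/
def hyperplaneForm (h : Σ _ : Fin d, Σ _ : Fin d, ℤ) : (Fin d → ℝ) →ᴬ[ℝ] ℝ :=
  ((.proj h.1 : (Fin d → ℝ) →L[ℝ] ℝ) - .proj h.2.1).toContinuousAffineMap -
    .const ℝ (Fin d → ℝ) (h.2.2 : ℝ)

theorem hyperplaneForm_apply (i j : Fin d) (s : ℤ) (a : Fin d → ℝ) :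
    hyperplaneForm ⟨i, j, s⟩ a = a i - a j - s := by
  simp [hyperplaneForm]

theorem hyperplaneForm_swap (i j : Fin d) (s : ℤ) (a : Fin d → ℝ) :
    hyperplaneForm ⟨j, i, -s⟩ a = -hyperplaneForm ⟨i, j, s⟩ a := by
  simp only [hyperplaneForm_apply]
  push_cast
  ring

theorem hyperplaneForm_diag (i : Fin d) (s : ℤ) (a : Fin d → ℝ) :
    hyperplaneForm ⟨i, i, s⟩ a = -s := by
  rw [hyperplaneForm_apply, sub_self, zero_sub]

/-- `a` lies on no hyperplane of `A_d(lam)`. -/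
def IsGeneric (lam : Fin d → ℕ) (a : Fin d → ℝ) : Prop :=
  ∀ h ∈ hyperplaneIndex lam, hyperplaneForm h a ≠ 0

theorem compl_sUnion_deformedBraid (lam : Fin d → ℕ) :
    (⋃₀ deformedBraid lam)ᶜ = {a | IsGeneric lam a} := by
  ext a
  simp only [Set.mem_compl_iff, Set.mem_sUnion, Set.mem_ofPred_eq, IsGeneric, Sigma.forall,
    mem_hyperplaneIndex, hyperplaneForm_apply, sub_ne_zero]
  constructor
  · exact fun h i j s ⟨hij, hs⟩ heq => h ⟨_, ⟨i, j, hij, s, hs.1, hs.2, rfl⟩, heq⟩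
  · rintro h ⟨_, ⟨i, j, hij, s, hs₁, hs₂, rfl⟩, heq⟩
    exact h i j s ⟨hij, hs₁, hs₂⟩ heq

theorem forall_step_pair_iff (hlam : ∀ i, 0 < lam i) {Q : (Σ _ : Fin d, Σ _ : Fin d, ℤ) → Prop}
    (hdiag : ∀ i s, Q ⟨i, i, s⟩) (hswap : ∀ i j s, Q ⟨i, j, s⟩ → Q ⟨j, i, -s⟩) :
    (∀ p q : Step lam, Q ⟨p.1, q.1, (q.2 : ℤ) - (p.2 : ℤ)⟩) ↔ ∀ h ∈ hyperplaneIndex lam, Q h := by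
  constructor
  · rintro hQ ⟨i, j, s⟩ hs
    rw [mem_hyperplaneIndex] at hs
    have hi := hlam i
    have hj := hlam j
    simpa using hQ ⟨i, (-s).toNat, by omega⟩ ⟨j, s.toNat, by omega⟩
  · rintro hQ ⟨i, k⟩ ⟨j, l⟩
    rcases lt_trichotomy i j with hij | rfl | hij
    · exact hQ _ (mem_hyperplaneIndex.2 ⟨hij, by omega, by omega⟩)
    · exact hdiag _ _
    · rw [← neg_sub]
      exact hswap _ _ _ (hQ _ (mem_hyperplaneIndex.2 ⟨hij, by omega, by omega⟩))

end Arrangement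

section Components

theorem connectedComponentIn_eq_iff_forall_mul_pos {V ι : Type*} [AddCommGroup V] [Module ℝ V]
    [TopologicalSpace V] [IsTopologicalAddGroup V] [ContinuousSMul ℝ V] {T : Finset ι}
    {f : ι → V →ᴬ[ℝ] ℝ} {a b : V} (ha : ∀ h ∈ T, f h a ≠ 0) :
    connectedComponentIn {x | ∀ h ∈ T, f h x ≠ 0} a =
      connectedComponentIn {x | ∀ h ∈ T, f h x ≠ 0} b ↔ ∀ h ∈ T, 0 < f h b * f h a := by
  set S := {x | ∀ h ∈ T, f h x ≠ 0}
  constructor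
  · intro heq h hh
    have haC : a ∈ connectedComponentIn S a := mem_connectedComponentIn ha
    have hbC : b ∈ connectedComponentIn S a :=
      heq ▸ mem_connectedComponentIn (connectedComponentIn_nonempty_iff.1 ⟨a, heq ▸ haC⟩)
    have hconn : (f h '' connectedComponentIn S a).OrdConnected :=
      (isPreconnected_connectedComponentIn.image _ (f h).continuous.continuousOn).ordConnected
    have hzero : (0 : ℝ) ∉ f h '' connectedComponentIn S a := by
      rintro ⟨x, hx, hx₀⟩
      exact connectedComponentIn_subset _ _ hx h hh hx₀
    by_contra! hle
    rcases mul_nonpos_iff.1 hle with hsign | hsign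
    · exact hzero (hconn.out ⟨a, haC, rfl⟩ ⟨b, hbC, rfl⟩ hsign.symm)
    · exact hzero (hconn.out ⟨b, hbC, rfl⟩ ⟨a, haC, rfl⟩ hsign)
  · intro hpos
    have hsegment : segment ℝ a b ⊆ S := by
      intro x hx h hh
      have hconvex : Convex ℝ {x | 0 < f h a * f h x} :=
        (convex_Ioi (0 : ℝ)).affine_preimage (f h a • (f h : V →ᵃ[ℝ] ℝ))
      have hx : 0 < f h a * f h x := hconvex.segment_subset (mul_self_pos.2 (ha h hh))
        (by simpa [mul_comm] using hpos h hh) hx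
      exact right_ne_zero_of_mul hx.ne'
    exact connectedComponentIn_eq ((convex_segment a b).isPreconnected.subset_connectedComponentIn
      (left_mem_segment ℝ a b) hsegment (right_mem_segment ℝ a b))

theorem regions_deformedBraid {d : ℕ} (lam : Fin d → ℕ) :
    regions (deformedBraid lam) = Set.range fun a : {a // IsGeneric lam a} =>
      connectedComponentIn {x | IsGeneric lam x} a.1 := by
  ext R
  simp only [regions, compl_sUnion_deformedBraid, Set.mem_ofPred_eq, Set.mem_range, Subtype.exists,
    exists_prop, eq_comm]

end Components

section Ranges

variable {α β γ : Type*}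

theorem nonempty_equiv_range {f : α → β} {g : α → γ} (h : ∀ a b, f a = f b ↔ g a = g b) :
    Nonempty (Set.range f ≃ Set.range g) :=
  ⟨(Setoid.quotientKerEquivRange f).symm.trans
    ((Quotient.congrRight h).trans (Setoid.quotientKerEquivRange g))⟩

theorem nonempty_orderIso_range [PartialOrder β] [PartialOrder γ] {f : α → β} {g : α → γ}
    (h : ∀ a b, f a ≤ f b ↔ g a ≤ g b) : Nonempty (Set.range f ≃o Set.range g) := by
  choose p hp using fun x : Set.range f => x.2
  let φ : Set.range f → Set.range g := fun x => ⟨g (p x), p x, rfl⟩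
  have hφ (x y) : φ x ≤ φ y ↔ x ≤ y := by
    rw [← Subtype.coe_le_coe, ← Subtype.coe_le_coe, ← hp x, ← hp y]
    exact (h _ _).symm
  have hsurj : Function.Surjective φ := by
    rintro ⟨_, a, rfl⟩
    have hpa : f (p ⟨f a, a, rfl⟩) = f a := hp _
    exact ⟨⟨f a, a, rfl⟩, Subtype.ext (le_antisymm ((h _ _).1 hpa.le) ((h _ _).1 hpa.ge))⟩
  exact ⟨RelIso.ofSurjective (OrderEmbedding.ofMapLEIff φ hφ) hsurj⟩

end Ranges

section LowerFaces

variable {d : ℕ} {lam : Fin d → ℕ} {r : ℝ}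

/-- The linear functional `x ↦ a_1 x_1 + ... + a_d x_d + r x_{d+1}`. -/
def functional (r : ℝ) (a : Fin d → ℝ) : Space d →ₗ[ℝ] ℝ :=
  (Fintype.linearCombination ℝ a).coprod (LinearMap.toSpanSingleton ℝ ℝ r)

theorem functional_apply (r : ℝ) (a : Fin d → ℝ) (x : Space d) :
    functional r a x = ∑ i, x.1 i * a i + x.2 * r := by
  simp [functional, Fintype.linearCombination_apply]

theorem functional_mem_lowerFunctionals (hr : 0 < r) (a : Fin d → ℝ) :
    functional r a ∈ lowerFunctionals d := by
  simpa [lowerFunctionals, functional_apply] using hr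

theorem exists_eq_smul_functional (hr : r ≠ 0) {c : Space d →ₗ[ℝ] ℝ} (hc : c (0, 1) ≠ 0) :
    ∃ a, c = (c (0, 1) / r) • functional r a := by
  refine ⟨fun i => c (Pi.single i 1, 0) / (c (0, 1) / r), ?_⟩
  refine LinearMap.prod_ext (LinearMap.pi_ext' fun i => LinearMap.ext_ring ?_)
    (LinearMap.ext_ring ?_)
  · simp [functional_apply, Pi.single_apply, mul_div_cancel₀ _ (div_ne_zero hc hr)]
  · simp [functional_apply, hr]

theorem lowerFaces_eq_range (hr : 0 < r) {P : Set (Space d)}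
    (hP : ∀ a, (face (functional r a) P).Nonempty) :
    lowerFaces P = Set.range fun a => face (functional r a) P := by
  ext F
  constructor
  · rintro ⟨-, c, hc, rfl⟩
    obtain ⟨a, ha⟩ := exists_eq_smul_functional hr.ne' hc.ne'
    refine ⟨a, ?_⟩
    change face (functional r a) P = face c P
    rw [ha, face_smul (div_pos hc hr)]
  · rintro ⟨a, rfl⟩
    exact ⟨hP a, _, functional_mem_lowerFunctionals hr a, rfl⟩

theorem functional_coneNormal (a : Fin d → ℝ) (i j : Fin d) (s : ℤ) :
    functional 1 a (coneNormal i j s) = hyperplaneForm ⟨i, j, s⟩ a := by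
  simp [functional_apply, coneNormal, hyperplaneForm_apply, sub_mul, Finset.sum_sub_distrib,
    Pi.single_apply, ← sub_eq_add_neg]

/-- The normal vectors that generate the polar zonotope; `none` stands for the hyperplane
`x_{d+1} = 0`. -/
def coneGenerator (w₀ : ℝ) (w : Fin d → Fin d → ℤ → ℝ) :
    Option (Σ _ : Fin d, Σ _ : Fin d, ℤ) → Space d
  | none => w₀ • (0, 1)
  | some ⟨i, j, s⟩ => w i j s • coneNormal i j s

theorem isZonotopalOn_polarZonotope (w₀ : ℝ) (w : Fin d → Fin d → ℤ → ℝ) :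
    IsZonotopalOn Set.univ (polarZonotope lam w₀ w) (hyperplaneIndex lam).insertNone
      (coneGenerator w₀ w) := by
  convert isZonotopalOn_zonotope _ _
  rw [polarZonotope, Finset.sum_insertNone, hyperplaneIndex, Finset.sum_sigma]
  simp only [Finset.sum_sigma, coneGenerator]

theorem face_polarZonotope_subset_iff (w₀ : ℝ) {w : Fin d → Fin d → ℤ → ℝ}
    (hw : ∀ i j s, w i j s ≠ 0) (a b : Fin d → ℝ) :
    face (functional 1 a) (polarZonotope lam w₀ w) ⊆
        face (functional 1 b) (polarZonotope lam w₀ w) ↔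
      ∀ h ∈ hyperplaneIndex lam, SignLE (hyperplaneForm h b) (hyperplaneForm h a) := by
  rw [(isZonotopalOn_polarZonotope w₀ w).face_subset_face_iff
    (fun _ _ _ => .of_forall fun _ => Set.mem_univ _) (Set.mem_univ _) (Set.mem_univ _),
    Finset.forall_mem_insertNone]
  simp only [Sigma.forall, coneGenerator, map_smul, smul_eq_mul, functional_coneNormal,
    signLE_mul_left_iff (hw _ _ _), and_iff_right_iff_imp]
  intro _
  simpa [functional_apply] using SignLE.refl w₀

-- The coefficient `1 / 2` compensates for the `2` in the increments `2k + 1`.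
theorem functional_stepDifference (a : Fin d → ℝ) (p q : Step lam) :
    functional (1 / 2) a (stepDifference (p, q)) = (4 * (∑ i, lam i : ℕ) : ℝ)⁻¹ *
      hyperplaneForm ⟨p.1, q.1, (q.2 : ℤ) - (p.2 : ℤ)⟩ a := by
  rw [stepDifference, map_smul, smul_eq_mul, functional_apply, hyperplaneForm_apply]
  simp only [stepVector, Prod.fst_sub, Prod.snd_sub, Pi.sub_apply, sub_mul, Finset.sum_sub_distrib,
    Pi.single_apply, ite_mul, one_mul, zero_mul, Finset.sum_ite_eq', Finset.mem_univ, if_true]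
  push_cast
  ring

theorem stepDifference_eq_zero_iff (hn : 0 < ∑ i, lam i) {p q : Step lam} :
    stepDifference (p, q) = 0 ↔ p.1 = q.1 ∧ (q.2 : ℤ) - (p.2 : ℤ) = 0 := by
  have hscale : (4 * (∑ i, lam i : ℕ) : ℝ)⁻¹ ≠ 0 := by positivity
  obtain ⟨i, k⟩ := p
  obtain ⟨j, l⟩ := q
  have hindicator : (Pi.single i 1 : Fin d → ℝ) = Pi.single j 1 ↔ i = j :=
    ⟨fun h => by simpa [Pi.single_apply] using congrFun h i, fun h => h ▸ rfl⟩
  have hincrement : (2 * k + 1 : ℝ) = 2 * l + 1 ↔ (l : ℤ) - (k : ℤ) = 0 := by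
    rw [add_left_inj, mul_right_inj' two_ne_zero, Nat.cast_inj, eq_comm, sub_eq_zero, Nat.cast_inj]
  rw [stepDifference, smul_eq_zero_iff_right hscale, sub_eq_zero, Prod.ext_iff]
  exact and_congr hindicator hincrement

theorem face_pathPolytope_subset_iff (hlam : ∀ i, 0 < lam i) (hn : 0 < ∑ i, lam i)
    (a b : Fin d → ℝ) :
    face (functional (1 / 2) a) (pathPolytope lam) ⊆
        face (functional (1 / 2) b) (pathPolytope lam) ↔
      ∀ h ∈ hyperplaneIndex lam, SignLE (hyperplaneForm h b) (hyperplaneForm h a) := by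
  have hscale : (4 * (∑ i, lam i : ℕ) : ℝ)⁻¹ ≠ 0 := by positivity
  rw [(isZonotopalOn_pathPolytope hn).face_subset_face_iff
    (isAlgebraicallyOpen_lowerFunctionals d) (functional_mem_lowerFunctionals one_half_pos a)
    (functional_mem_lowerFunctionals one_half_pos b)]
  simp only [Finset.mem_univ, true_imp_iff, Prod.forall, functional_stepDifference,
    signLE_mul_left_iff hscale]
  refine forall_step_pair_iff (Q := fun h => SignLE (hyperplaneForm h b) (hyperplaneForm h a)) hlam
    (fun i s => ?_) fun i j s h => ?_
  · simpa only [hyperplaneForm_diag] using SignLE.refl _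
  · rwa [hyperplaneForm_swap, hyperplaneForm_swap, signLE_neg_iff]

theorem exists_face_pathPolytope_eq_singleton_iff (hlam : ∀ i, 0 < lam i) (hn : 0 < ∑ i, lam i)
    (a : Fin d → ℝ) :
    (∃ z, face (functional (1 / 2) a) (pathPolytope lam) = {z}) ↔ IsGeneric lam a := by
  have hscale : (4 * (∑ i, lam i : ℕ) : ℝ)⁻¹ ≠ 0 := by positivity
  rw [(isZonotopalOn_pathPolytope hn).exists_face_eq_singleton_iff
    (isAlgebraicallyOpen_lowerFunctionals d) (functional_mem_lowerFunctionals one_half_pos a)]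
  simp only [Finset.mem_univ, true_imp_iff, Prod.forall, functional_stepDifference,
    mul_eq_zero, hscale, false_or, stepDifference_eq_zero_iff hn]
  rw [forall_step_pair_iff (Q := fun h => hyperplaneForm h a = 0 → h.1 = h.2.1 ∧ h.2.2 = 0) hlam
    (fun i s h => ⟨rfl, by simpa [hyperplaneForm_diag] using h⟩) fun i j s h => by
      simpa [hyperplaneForm_swap, eq_comm] using h]
  refine forall₂_congr fun h hh => imp_congr_right fun _ => ?_
  exact iff_of_false (fun heq => (mem_hyperplaneIndex.1 hh).1.ne heq.1) id

theorem lowerFaces_pathPolytope_eq_range (hn : 0 < ∑ i, lam i) :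
    lowerFaces (pathPolytope lam) =
      Set.range fun a => face (functional (1 / 2) a) (pathPolytope lam) :=
  lowerFaces_eq_range one_half_pos fun a => (isZonotopalOn_pathPolytope hn).face_nonempty
    (functional_mem_lowerFunctionals one_half_pos a)

theorem lowerFaces_polarZonotope_eq_range (w₀ : ℝ) (w : Fin d → Fin d → ℤ → ℝ) :
    lowerFaces (polarZonotope lam w₀ w) =
      Set.range fun a => face (functional 1 a) (polarZonotope lam w₀ w) :=
  lowerFaces_eq_range one_pos fun _ =>
    (isZonotopalOn_polarZonotope w₀ w).face_nonempty (Set.mem_univ _)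

theorem nonempty_lowerFaces_orderIso (hlam : ∀ i, 0 < lam i) (hn : 0 < ∑ i, lam i) (w₀ : ℝ)
    {w : Fin d → Fin d → ℤ → ℝ} (hw : ∀ i j s, w i j s ≠ 0) :
    Nonempty (lowerFaces (pathPolytope lam) ≃o lowerFaces (polarZonotope lam w₀ w)) := by
  rw [lowerFaces_pathPolytope_eq_range hn, lowerFaces_polarZonotope_eq_range]
  exact nonempty_orderIso_range fun a b => (face_pathPolytope_subset_iff hlam hn a b).trans
    (face_polarZonotope_subset_iff w₀ hw a b).symm

theorem image_singleton_lowerVertices_pathPolytope (hlam : ∀ i, 0 < lam i)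
    (hn : 0 < ∑ i, lam i) :
    singleton '' lowerVertices (pathPolytope lam) = Set.range fun a : {a // IsGeneric lam a} =>
      face (functional (1 / 2) a.1) (pathPolytope lam) := by
  ext F
  simp only [lowerVertices, lowerFaces_pathPolytope_eq_range hn, Set.mem_image, Set.mem_ofPred_eq,
    Set.mem_range, Subtype.exists, exists_prop,
    ← exists_face_pathPolytope_eq_singleton_iff hlam hn]
  constructor
  · rintro ⟨z, ⟨a, ha⟩, rfl⟩
    exact ⟨a, ⟨z, ha⟩, ha⟩
  · rintro ⟨a, ⟨z, ha⟩, rfl⟩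
    exact ⟨z, ⟨a, ha⟩, ha.symm⟩

theorem face_pathPolytope_eq_iff_connectedComponentIn_eq (hlam : ∀ i, 0 < lam i)
    (hn : 0 < ∑ i, lam i) {a b : Fin d → ℝ} (ha : IsGeneric lam a) (hb : IsGeneric lam b) :
    face (functional (1 / 2) a) (pathPolytope lam) =
        face (functional (1 / 2) b) (pathPolytope lam) ↔
      connectedComponentIn {x | IsGeneric lam x} a =
        connectedComponentIn {x | IsGeneric lam x} b := by
  have hsubset {a b : Fin d → ℝ} (hb : IsGeneric lam b) :
      face (functional (1 / 2) a) (pathPolytope lam) ⊆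
          face (functional (1 / 2) b) (pathPolytope lam) ↔
        ∀ h ∈ hyperplaneIndex lam, 0 < hyperplaneForm h a * hyperplaneForm h b :=
    (face_pathPolytope_subset_iff hlam hn a b).trans
      (forall₂_congr fun h hh => signLE_iff_mul_pos (hb h hh))
  have hcomponent : connectedComponentIn {x | IsGeneric lam x} a =
      connectedComponentIn {x | IsGeneric lam x} b ↔ _ :=
    connectedComponentIn_eq_iff_forall_mul_pos ha
  rw [Set.Subset.antisymm_iff, hsubset hb, hsubset ha, hcomponent]
  exact and_iff_right_of_imp fun hpos h hh => mul_comm (hyperplaneForm h a) _ ▸ hpos h hh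

theorem nonempty_lowerVertices_equiv (hlam : ∀ i, 0 < lam i) (hn : 0 < ∑ i, lam i) :
    Nonempty (lowerVertices (pathPolytope lam) ≃ regions (deformedBraid lam)) := by
  have hrange := nonempty_equiv_range fun a b : {a // IsGeneric lam a} =>
    face_pathPolytope_eq_iff_connectedComponentIn_eq hlam hn a.2 b.2
  rw [← image_singleton_lowerVertices_pathPolytope hlam hn, ← regions_deformedBraid] at hrange
  exact hrange.map (Equiv.Set.image _ _ Set.singleton_injective).trans

end LowerFaces

end MonotonePath

end

theorem corollary2p2 {d : ℕ} (hd : 0 < d) (lam : Fin d → ℕ) (hlam : ∀ i, 0 < lam i) :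
    (∀ (w₀ : ℝ) (w : Fin d → Fin d → ℤ → ℝ), w₀ ≠ 0 → (∀ i j s, w i j s ≠ 0) →
      Nonempty (MonotonePath.lowerFaces (MonotonePath.pathPolytope lam) ≃o
        MonotonePath.lowerFaces (MonotonePath.polarZonotope lam w₀ w))) ∧
    Nonempty (MonotonePath.lowerVertices (MonotonePath.pathPolytope lam) ≃
      MonotonePath.regions (MonotonePath.deformedBraid lam)) := by
  have hn : 0 < ∑ i, lam i := Finset.sum_pos (fun i _ => hlam i) ⟨⟨0, hd⟩, Finset.mem_univ _⟩
  exact ⟨fun w₀ _ _ hw => MonotonePath.nonempty_lowerFaces_orderIso hlam hn w₀ hw,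
    MonotonePath.nonempty_lowerVertices_equiv hlam hn⟩
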